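/- Let $k \ge 4$. For integers $a \le b$ and $p\ge 1$ write $[a,b]_p$ for the set of integers $x$ with $a \le x \le b$ and $x \equiv a \pmod p$, and $[a,b]=[a,b]_1$. For a set $S \subseteq \{1,\dots,\lfloor n/2\rfloor\}$ the circulant graph on $\mathbb{Z}/n\mathbb{Z}$ determined by $S$ joins two distinct vertices $x,y$ iff $x-y$ or $y-x$ is congruent modulo $n$ to an element of $S$. A subgraph $H$ of a graph has diameter two if any two vertices of $H$ are joined by a path in $H$ with at most two edges. (1) Let $s \ge 1$ and $n = 2sk+1$. For $1 \le i \le k$ let $C_i$ be the circulant graph on $\mathbb{Z}/n\mathbb{Z}$ determined by the set $D_i$, where $D_1=[1,2s-1]_2$ and $D_2=[2,2s]_2$; if $3\mid k$, then $D_{2k/3-1}=[(\tfrac{2k}{3}-2)s+2,\ \tfrac{2k}{3}s]_2$ and $D_{2k/3}=[(\tfrac{2k}{3}-2)s+1,\ \tfrac{2k}{3}s-1]_2$; and $D_i=[(i-1)s+1,\ is]$ for all other $i$. Then all $D_i \subseteq \{1,\dots,\lfloor n/2\rfloor\}$, the edge sets of $C_1,\dots,C_k$ form a partition of the edge set of the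 complete graph on $\mathbb{Z}/n\mathbb{Z}$, and for every $i$ every diameter two subgraph of $C_i$ has at most $2s+7$ vertices. (2) For $n \ge 1$ let $f_k(n)$ be the largest $m$ such that for every colouring of the edges of $K_n$ with $k$ colours some colour class contains a diameter two subgraph on at least $m$ vertices. Then $f_k(n) \ge 1+\frac{n-1}{k}$ for all $n\ge 1$, and this bound is asymptotically tight: $f_k(n)\big/\bigl(1+\frac{n-1}{k}\bigr) \to 1$ as $n \to \infty$. -/

import Mathlib

/-- The set `[a, b]_p` of all integers `x` with `a ≤ x ≤ b` and `x ≡ a (mod p)`. -/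
def modInterval (p a b : ℕ) : Set ℕ :=
  {x | a ≤ x ∧ x ≤ b ∧ x ≡ a [MOD p]}

/-- The circulant ("circle") graph on `ℤ/n` determined by a set `S` of distances: two distinct
vertices `x`, `y` are adjacent iff `x - y` or `y - x` is the residue of an element of `S`. -/
def circleGraph (n : ℕ) (S : Set ℕ) : SimpleGraph (ZMod n) :=
  SimpleGraph.circulantGraph ((fun d : ℕ => (d : ZMod n)) '' S)

/-- A subgraph has diameter (at most) two: any two of its vertices are joined by a path with at
most two edges that lies inside the subgraph. -/
def IsDiameterTwo {V : Type*} {G : SimpleGraph V} (H : G.Subgraph) : Prop :=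
  ∀ x y : H.verts, ∃ p : H.coe.Walk x y, p.IsPath ∧ p.length ≤ 2

/-- The `i`-th distance set (`1 ≤ i ≤ k`) of the construction for `n = 2sk + 1`.
* For `i = 1, 2` it is `[i, 2s - 2 + i]_2`.
* If `3 ∣ k` and `i = 2k/3 - 1`, it is `[(2k/3 - 2)s + 2, (2k/3)s]_2`.
* If `3 ∣ k` and `i = 2k/3`, it is `[(2k/3 - 2)s + 1, (2k/3)s - 1]_2`.
* Otherwise it is the interval `[(i - 1)s + 1, is]`. -/
def distanceSet (k s i : ℕ) : Set ℕ :=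
  if i ≤ 2 then modInterval 2 i (2 * s - 2 + i)
  else if 3 * (i + 1) = 2 * k then modInterval 2 ((i - 1) * s + 2) ((i + 1) * s)
  else if 3 * i = 2 * k then modInterval 2 ((i - 2) * s + 1) (i * s - 1)
  else modInterval 1 ((i - 1) * s + 1) (i * s)

/-- The largest `m` such that, for every colouring of the edges of the complete graph on `n`
vertices with `k` colours, some colour class has a diameter two subgraph on at least `m`
vertices. -/
noncomputable def guaranteedSize (k n : ℕ) : ℕ :=
  sSup {m : ℕ | ∀ c : SimpleGraph.TopEdgeLabeling (Fin n) (Fin k),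
    ∃ (i : Fin k) (H : (c.labelGraph i).Subgraph), IsDiameterTwo H ∧ m ≤ H.verts.ncard}

/-! Let `n = 2sk + 1`. In a diameter two subgraph every difference of vertices is 0, plus or minus a
distance, or a sum of two such. Multiplying by a unit of `ℤ/n` only relabels vertices, and 2 is a
unit. Halving turns the parity classes `D_1`, `D_2`, `D_{2k/3-1}`, `D_{2k/3}` into plus or minus the
intervals `[(j-1)s+1, js]` with `j = k, 1, k/3, 2k/3+1`. So all colours reduce to such an interval,
never with `j = 2k/3`, and with `j = 2` only when `k = 6`. The index `2k/3` must be avoided: there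
`n = 3js + 1`, so three clusters spaced `js` apart could coexist.

For `j ≥ 3`, split the vertex set `X` into left ends, which have no other vertex less than `s`
behind them, and the rest. Seen from one left end, all lie in seven windows of length at most about
`s`, one per window (`card_leftEnds_le`). If `t + ps` and `t + qs` belong to the rest, then both
`(q-p)s` and some `(q-p)s + d` with `0 < d < s` are differences in `X`; `chain_difference` leaves so
few values of `q - p` that no progression of `2k` terms with step `s` contains three such points.
Averaging over translates bounds the rest by `2s`, hence `2s + 7` in total. For `j = 1, 2` the
vertex set unwraps to integers and has at most `2s + 1` elements.

For general `n`, restricting the construction with `s` about `n/(2k)` matches, up to a constant, the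
star given by pigeonhole. -/

/-! ### Two-step differences of an interval -/

/-- The integers of absolute value in `[(i - 1)s + 1, is]`, their sums of two, and `0`: the
differences of two vertices at distance at most two in the circle graph of that interval. -/
def IsTwoStep (s i a : ℤ) : Prop :=
  |a| ≤ s - 1 ∨ ((i - 1) * s + 1 ≤ |a| ∧ |a| ≤ i * s) ∨
    (2 * (i - 1) * s + 2 ≤ |a| ∧ |a| ≤ 2 * i * s)

lemma isTwoStep_zero {s i : ℤ} (hs : 1 ≤ s) : IsTwoStep s i 0 := by
  left; simpa using hs

lemma isTwoStep_of_interval {s i a : ℤ} (h : (i - 1) * s + 1 ≤ |a| ∧ |a| ≤ i * s) :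
    IsTwoStep s i a := Or.inr (Or.inl h)

/-- Opposite signs cancel to absolute value at most `s - 1`; equal signs land in the doubled
interval. -/
lemma isTwoStep_add {s i a b : ℤ} (ha : (i - 1) * s + 1 ≤ |a| ∧ |a| ≤ i * s)
    (hb : (i - 1) * s + 1 ≤ |b| ∧ |b| ≤ i * s) : IsTwoStep s i (a + b) := by
  obtain ⟨ha1, ha2⟩ := ha
  obtain ⟨hb1, hb2⟩ := hb
  unfold IsTwoStep
  have e1 : 2 * (i - 1) * s = 2 * (i * s) - 2 * s := by ring
  have e2 : 2 * i * s = 2 * (i * s) := by ring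
  have e3 : (i - 1) * s = i * s - s := by ring
  rw [e1, e2, e3]
  rw [e3] at ha1 hb1
  generalize i * s = p at *
  rcases abs_cases a with ⟨h1, h2⟩ | ⟨h1, h2⟩ <;> rcases abs_cases b with ⟨h3, h4⟩ | ⟨h3, h4⟩ <;>
    rcases abs_cases (a + b) with ⟨h5, h6⟩ | ⟨h5, h6⟩ <;> omega

lemma IsTwoStep.abs_le {s i a : ℤ} (hs : 1 ≤ s) (hi : 1 ≤ i) (h : IsTwoStep s i a) :
    |a| ≤ 2 * i * s := by
  rcases h with h | h | h
  · nlinarith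
  · nlinarith [h.2]
  · exact h.2

/-- A positive integer below `n = 2sk + 1` congruent mod `n` to an element of the set `IsTwoStep`
lies in that set, or its reflection does. -/
lemma isTwoStep_lift {n : ℕ} {s k i e a : ℤ} (hn : (n : ℤ) = 2 * s * k + 1) (hs : 1 ≤ s)
    (hi : 1 ≤ i) (hik : i ≤ k) (he : 0 < e) (hen : e < n)
    (ha : IsTwoStep s i a) (hae : (a : ZMod n) = (e : ZMod n)) :
    IsTwoStep s i e ∨ IsTwoStep s i (n - e) := by
  have h1 := ha.abs_le hs hi
  have h2 : 2 * i * s ≤ 2 * s * k := by nlinarith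
  have h3 : |a| < n := by omega
  rw [abs_lt] at h3
  rw [ZMod.intCast_eq_intCast_iff_dvd_sub] at hae
  obtain ⟨c, hc⟩ := hae
  have hc1 : c < 2 := by
    by_contra hh
    nlinarith
  have hc0 : 0 ≤ c := by
    by_contra hh
    have : c ≤ -1 := by omega
    nlinarith
  interval_cases c
  · left
    rwa [show e = a by omega]
  · right
    unfold IsTwoStep at *
    rwa [show (n : ℤ) - e = -a by omega, abs_neg]

lemma mul_lt_imp {s u v : ℤ} (hs : 1 ≤ s) (h : u * s < v * s) : u < v :=
  lt_of_mul_lt_mul_right h (by omega)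

/-- Location of a positive two-step difference relative to the multiples of `s`. -/
lemma IsTwoStep.quotient {s i c d : ℤ} (hc : 0 ≤ c) (hd : 1 ≤ d) (hds : d ≤ s)
    (h : IsTwoStep s i (c * s + d)) :
    (c = 0 ∧ d ≤ s - 1) ∨ c = i - 1 ∨ (c = 2 * i - 2 ∧ 2 ≤ d) ∨ c = 2 * i - 1 := by
  have hs : 1 ≤ s := hd.trans hds
  have key : ∀ u v : ℤ, u * s < v * s → u < v := fun u v h => mul_lt_imp hs h
  rw [IsTwoStep, abs_of_pos (by positivity)] at h
  rcases h with h | ⟨h, h1⟩ | ⟨h, h1⟩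
  · have := key c 1 (by linarith)
    obtain rfl : c = 0 := by omega
    omega
  · have := key (i - 1) (c + 1) (by linarith)
    have := key c i (by linarith)
    omega
  · have := key (2 * (i - 1)) (c + 1) (by linarith)
    have := key c (2 * i) (by linarith)
    obtain rfl | rfl : c = 2 * i - 2 ∨ c = 2 * i - 1 := by omega
    · have : 2 ≤ d := by linarith
      omega
    · omega

/-- Multiples `bs` that are allowed differences, together with some `bs + d`, `0 < d < s`. -/
lemma chain_difference {s k i b d : ℤ} (hk : 4 ≤ k) (hi : 3 ≤ i) (hik : i ≤ k)
    (h3 : 3 * i ≠ 2 * k) (hb : 0 < b) (hbk : b < 2 * k) (hd : 0 < d) (hds : d < s)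
    (h : IsTwoStep s i (b * s) ∨ IsTwoStep s i (2 * s * k + 1 - b * s))
    (h' : IsTwoStep s i (b * s + d) ∨ IsTwoStep s i (2 * s * k + 1 - (b * s + d))) :
    (b = i ∧ (i = k ∨ 3 * i = 2 * k + 1)) ∨ b = 2 * i - 1 ∨ (b = 2 * i ∧ 2 * i = k) ∨
      (b = 2 * k + 1 - i ∧ (3 * i = 2 * k + 2 ∨ 3 * i = 2 * k + 3)) ∨ b = 2 * k + 1 - 2 * i := by
  -- Each number is placed in its block `(cs, (c+1)s]`: `bs` ends block `b - 1`, and `n - bs` begins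
  -- block `2k - b`.
  rw [show b * s = (b - 1) * s + s by ring,
    show 2 * s * k + 1 - ((b - 1) * s + s) = (2 * k - b) * s + 1 by ring] at h
  rw [show 2 * s * k + 1 - (b * s + d) = (2 * k - b - 1) * s + (s + 1 - d) by ring] at h'
  have hB : b = i ∨ b = 2 * i - 1 ∨ b = 2 * i ∨ b = 2 * k + 1 - i ∨ b = 2 * k + 1 - 2 * i := by
    rcases h with h | h
    · have := h.quotient (by omega) (by omega) le_rfl
      omega
    · have := h.quotient (by omega) le_rfl (by omega)
      omega
  have hC : b = i - 1 ∨ b = 2 * i - 2 ∨ b = 2 * i - 1 ∨ b = 2 * k - 1 ∨ b = 2 * k - i ∨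
      b = 2 * k + 1 - 2 * i ∨ b = 2 * k - 2 * i := by
    rcases h' with h | h
    · have := h.quotient (by omega) (by omega) hds.le
      omega
    · have := h.quotient (by omega) (by omega) (by omega)
      omega
  clear h h'
  rcases hB with rfl | rfl | rfl | rfl | rfl <;> omega

/-! ### Counting along progressions -/

/-- Averaging over the translates of an arithmetic progression of length `m`. -/
lemma mul_card_le_of_progression {n : ℕ} [NeZero n] (X : Finset (ZMod n)) (s m c : ℕ)
    (h : ∀ t : ZMod n,
      ((Finset.range m).filter fun j => t + ((j * s : ℕ) : ZMod n) ∈ X).card ≤ c) :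
    m * X.card ≤ c * n := by
  have h1 : ∑ t : ZMod n,
      ((Finset.range m).filter fun j => t + ((j * s : ℕ) : ZMod n) ∈ X).card = m * X.card := by
    simp_rw [Finset.card_filter]
    rw [Finset.sum_comm]
    have : ∀ j ∈ Finset.range m,
        (∑ t : ZMod n, if t + ((j * s : ℕ) : ZMod n) ∈ X then 1 else 0) = X.card := by
      intro j _
      have := Equiv.sum_comp (Equiv.addRight ((j * s : ℕ) : ZMod n))
        (fun t => if t ∈ X then 1 else 0)
      simp only [Equiv.coe_addRight] at this
      refine Eq.trans ?_ (this.trans (by simp))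
      exact Finset.sum_congr rfl fun t _ => rfl
    rw [Finset.sum_congr rfl this]
    simp
  rw [← h1]
  refine (Finset.sum_le_sum fun t _ => h t).trans ?_
  simp [ZMod.card, mul_comm]

lemma card_le_two_of_no_increasing_triple {F : Finset ℕ}
    (h : ∀ a ∈ F, ∀ b ∈ F, ∀ c ∈ F, a < b → b < c → False) : F.card ≤ 2 := by
  by_contra hc
  obtain ⟨a, ha, b, hb, c, hc, hab, hac, hbc⟩ := Finset.two_lt_card.1 (not_le.1 hc)
  rcases lt_or_gt_of_ne hab with h1 | h1 <;> rcases lt_or_gt_of_ne hac with h2 | h2 <;>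
    rcases lt_or_gt_of_ne hbc with h3 | h3
  · exact h a ha b hb c hc h1 h3
  · exact h a ha c hc b hb h2 h3
  · omega
  · exact h c hc a ha b hb h2 h1
  · exact h b hb a ha c hc h1 h2
  · omega
  · exact h b hb c hc a ha h3 h2
  · exact h c hc b hb a ha h3 h1

/-! ### Left ends and the case `i ≥ 3` -/

/-- A signed label of the window of length `s` containing the integer `a`. -/
def windowLabel (s a : ℤ) : ℤ :=
  if |a| < s then 0 else if 0 < a then (a - 1) / s else -((-a - 1) / s)

lemma windowLabel_mem {s i a : ℤ} (hs : 1 ≤ s) (h : IsTwoStep s i a) :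
    windowLabel s a ∈
      ({0, i - 1, -(i - 1), 2 * i - 2, -(2 * i - 2), 2 * i - 1, -(2 * i - 1)} : Finset ℤ) := by
  have key : ∀ e : ℤ, s ≤ e → IsTwoStep s i e →
      (e - 1) / s = i - 1 ∨ (e - 1) / s = 2 * i - 2 ∨ (e - 1) / s = 2 * i - 1 := by
    intro e he h
    have h1 := Int.ediv_mul_add_emod (e - 1) s
    have h2 := Int.emod_nonneg (e - 1) (show s ≠ 0 by omega)
    have h3 := Int.emod_lt_of_pos (e - 1) (show 0 < s by omega)
    have h4 : 0 ≤ (e - 1) / s := Int.ediv_nonneg (by omega) (by omega)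
    rw [show e = (e - 1) / s * s + ((e - 1) % s + 1) by omega] at h
    have := h.quotient h4 (by omega) (by omega)
    rcases this with ⟨h5, h6⟩ | h | h | h
    · rw [h5] at h1
      omega
    all_goals omega
  unfold windowLabel
  simp only [Finset.mem_insert, Finset.mem_singleton]
  split_ifs with h1 h2
  · simp
  · rw [abs_of_pos h2] at h1
    have := key a (by omega) h
    omega
  · rw [abs_of_nonpos (by omega)] at h1
    have := key (-a) (by omega) (by unfold IsTwoStep at *; rwa [abs_neg])
    omega

lemma abs_sub_lt_of_windowLabel_eq {s a b : ℤ} (hs : 1 ≤ s)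
    (h : windowLabel s a = windowLabel s b) (hb : s < |b|) (ha : s < |a|) : |a - b| < s := by
  have key : ∀ e : ℤ, s < e → 1 ≤ (e - 1) / s ∧ (e - 1) / s * s + 1 ≤ e ∧
      e ≤ (e - 1) / s * s + s := by
    intro e he
    have h1 := Int.ediv_mul_add_emod (e - 1) s
    have h2 := Int.emod_nonneg (e - 1) (show s ≠ 0 by omega)
    have h3 := Int.emod_lt_of_pos (e - 1) (show 0 < s by omega)
    have h4 : 1 ≤ (e - 1) / s := (Int.le_ediv_iff_mul_le (by omega)).2 (by omega)
    omega
  unfold windowLabel at h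
  simp only [if_neg (not_lt.2 ha.le), if_neg (not_lt.2 hb.le)] at h
  rw [abs_lt]
  rw [lt_abs] at ha hb
  split_ifs at h with h1 h2 h2
  · have h3 := key a (by omega)
    have h4 := key b (by omega)
    rw [h] at h3
    omega
  · have h3 := key a (by omega)
    have h4 := key (-b) (by omega)
    omega
  · have h3 := key (-a) (by omega)
    have h4 := key b (by omega)
    omega
  · have h3 := key (-a) (by omega)
    have h4 := key (-b) (by omega)
    rw [neg_inj.1 h] at h3
    omega

lemma windowLabel_ne_zero {s a : ℤ} (hs : 1 ≤ s) (ha : s < |a|) : windowLabel s a ≠ 0 := by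
  have key : ∀ e : ℤ, s < e → 1 ≤ (e - 1) / s := fun e he =>
    (Int.le_ediv_iff_mul_le (by omega)).2 (by omega)
  unfold windowLabel
  rw [if_neg (not_lt.2 ha.le)]
  rw [lt_abs] at ha
  split_ifs with h
  · have := key a (by omega)
    omega
  · have := key (-a) (by omega)
    omega

/-- Rules out `|a| = s`, the one value outside the central window that would also receive label 0.
-/
lemma IsTwoStep.abs_lt_or {s i a : ℤ} (hs : 1 ≤ s) (hi : 3 ≤ i) (h : IsTwoStep s i a) :
    |a| < s ∨ s < |a| := by
  rcases h with h | h | h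
  · exact Or.inl (by omega)
  · exact Or.inr (by nlinarith)
  · exact Or.inr (by nlinarith)

/-- The elements `x` of `X` such that no `x - d` with `0 < d < s` lies in `X`. -/
def leftEnds {n : ℕ} (s : ℤ) (X : Finset (ZMod n)) : Finset (ZMod n) :=
  open Classical in X.filter fun x => ∀ d : ℤ, 0 < d → d < s → x - (d : ZMod n) ∉ X

lemma mem_leftEnds {n : ℕ} {s : ℤ} {X : Finset (ZMod n)} {x : ZMod n} :
    x ∈ leftEnds s X ↔ x ∈ X ∧ ∀ d : ℤ, 0 < d → d < s → x - (d : ZMod n) ∉ X := by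
  classical
  unfold leftEnds
  simp

lemma eq_of_mem_leftEnds {n : ℕ} {s : ℤ} {X : Finset (ZMod n)} {x y : ZMod n}
    (hx : x ∈ leftEnds s X) (hy : y ∈ leftEnds s X) {a : ℤ} (ha : (a : ZMod n) = x - y)
    (has : |a| < s) : x = y := by
  rw [mem_leftEnds] at hx hy
  rw [abs_lt] at has
  rcases lt_trichotomy a 0 with h | h | h
  · refine absurd hx.1 ?_
    have := hy.2 (-a) (by omega) (by omega)
    rwa [Int.cast_neg, ha, show y - -(x - y) = x by ring] at this
  · rw [h, Int.cast_zero] at ha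
    exact sub_eq_zero.1 ha.symm
  · refine absurd hy.1 ?_
    have := hx.2 a h (by omega)
    rwa [ha, show x - (x - y) = y by ring] at this

/-- Relative to a fixed left end `r`, the window label is injective on left ends: two in one window
differ by less than `s`, so they coincide. Only seven labels occur. -/
lemma card_leftEnds_le {n : ℕ} {s i : ℤ} {X : Finset (ZMod n)} (hs : 1 ≤ s) (hi : 3 ≤ i)
    (hX : ∀ x ∈ X, ∀ y ∈ X, ∃ a : ℤ, (a : ZMod n) = x - y ∧ IsTwoStep s i a) :
    (leftEnds s X).card ≤ 7 := by
  classical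
  rcases (leftEnds s X).eq_empty_or_nonempty with h | ⟨r, hr⟩
  · simp [h]
  have hsub : ∀ x ∈ leftEnds s X, x ∈ X := fun x hx => (mem_leftEnds.1 hx).1
  choose! f hf using fun x hx => hX x (hsub x hx) r (hsub r hr)
  have hcard : ({0, i - 1, -(i - 1), 2 * i - 2, -(2 * i - 2), 2 * i - 1, -(2 * i - 1)} :
      Finset ℤ).card ≤ 7 := (Finset.card_insert_le _ _).trans (Nat.succ_le_succ Finset.card_le_six)
  refine (Finset.card_le_card_of_injOn (fun x => windowLabel s (f x)) ?_ ?_).trans hcard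
  · intro x hx
    exact windowLabel_mem hs (hf x hx).2
  · intro x hx y hy hxy
    simp only [Finset.mem_coe] at hx hy
    obtain ⟨hx1, hx2⟩ := hf x hx
    obtain ⟨hy1, hy2⟩ := hf y hy
    have hzero : ∀ z : ℤ, |z| < s → windowLabel s z = 0 := fun z hz => if_pos hz
    rcases hx2.abs_lt_or hs hi with h1 | h1 <;> rcases hy2.abs_lt_or hs hi with h2 | h2
    · rw [eq_of_mem_leftEnds hx hr hx1 h1, eq_of_mem_leftEnds hy hr hy1 h2]
    · exact absurd (hxy.symm.trans (hzero _ h1)) (windowLabel_ne_zero hs h2)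
    · exact absurd (hxy.trans (hzero _ h2)) (windowLabel_ne_zero hs h1)
    · refine eq_of_mem_leftEnds hx hy (a := f x - f y) ?_ (abs_sub_lt_of_windowLabel_eq hs hxy h2 h1)
      rw [Int.cast_sub, hx1, hy1]
      ring

lemma card_le_of_isTwoStep {k s i : ℕ} (hk : 4 ≤ k) (hs : 1 ≤ s) (hi : 3 ≤ i) (hik : i ≤ k)
    (h3 : 3 * i ≠ 2 * k) (X : Finset (ZMod (2 * s * k + 1)))
    (hX : ∀ x ∈ X, ∀ y ∈ X, ∃ a : ℤ, (a : ZMod (2 * s * k + 1)) = x - y ∧ IsTwoStep s i a) :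
    X.card ≤ 2 * s + 7 := by
  classical
  have hR := card_leftEnds_le (by omega) (by omega) hX
  have hchain : 2 * k * (X \ leftEnds s X).card ≤ 2 * (2 * s * k + 1) := by
    refine mul_card_le_of_progression _ s (2 * k) 2 fun t => ?_
    refine card_le_two_of_no_increasing_triple fun a ha b hb c hc hab hbc => ?_
    simp only [Finset.mem_filter, Finset.mem_range] at ha hb hc
    have key : ∀ p q : ℕ, p < q → q < 2 * k →
        t + ((p * s : ℕ) : ZMod (2 * s * k + 1)) ∈ X \ leftEnds s X →
        t + ((q * s : ℕ) : ZMod (2 * s * k + 1)) ∈ X \ leftEnds s X →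
        ((q - p : ℤ) = i ∧ ((i : ℤ) = k ∨ 3 * (i : ℤ) = 2 * k + 1)) ∨ (q - p : ℤ) = 2 * i - 1 ∨
        ((q - p : ℤ) = 2 * i ∧ 2 * (i : ℤ) = k) ∨
        ((q - p : ℤ) = 2 * k + 1 - i ∧ (3 * (i : ℤ) = 2 * k + 2 ∨ 3 * (i : ℤ) = 2 * k + 3)) ∨
        (q - p : ℤ) = 2 * k + 1 - 2 * i := by
      intro p q hpq hqk hp hq
      rw [Finset.mem_sdiff, mem_leftEnds] at hp hq
      obtain ⟨hp1, hp2⟩ := hp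
      push Not at hp2
      -- Not being a left end supplies a second point `t + ps - d` of `X`, hence the second
      -- difference `(q-p)s + d`.
      obtain ⟨d, hd, hds, hpd⟩ := hp2 hp1
      obtain ⟨a1, ha1, ha1'⟩ := hX _ hq.1 _ hp1
      obtain ⟨a2, ha2, ha2'⟩ := hX _ hq.1 _ hpd
      have hn : ((2 * s * k + 1 : ℕ) : ℤ) = 2 * s * k + 1 := by push_cast; ring
      have hb0 : (0 : ℤ) < q - p := by omega
      have hb1 : (q - p : ℤ) < 2 * k := by omega
      have hs' : (1 : ℤ) ≤ s := by omega
      have hb2 : ((q - p : ℤ) + 1) * s ≤ 2 * k * s :=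
        mul_le_mul_of_nonneg_right (by omega) (by omega)
      have hbs : (0 : ℤ) < (q - p) * s := by positivity
      have h1 := isTwoStep_lift (n := 2 * s * k + 1) (s := s) (k := k) (i := i)
        (e := (q - p) * s) hn hs' (by omega) (by omega) hbs (by rw [hn]; linarith) ha1'
        (by rw [ha1]; push_cast; ring)
      have h2 := isTwoStep_lift (n := 2 * s * k + 1) (s := s) (k := k) (i := i)
        (e := (q - p) * s + d) hn hs' (by omega) (by omega) (by omega) (by rw [hn]; linarith) ha2'
        (by rw [ha2]; push_cast; ring)
      rw [hn] at h1 h2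
      exact chain_difference (by omega) (by omega) (by omega) (by omega) hb0 hb1 hd hds h1 h2
    have h1 := key a b hab hb.1 ha.2 hb.2
    have h2 := key b c hbc hc.1 hb.2 hc.2
    have h4 := key a c (hab.trans hbc) hc.1 ha.2 hc.2
    clear key hX hR
    obtain ⟨u, hu⟩ : ∃ u : ℤ, u = b - a := ⟨_, rfl⟩
    obtain ⟨v, hv⟩ : ∃ v : ℤ, v = c - b := ⟨_, rfl⟩
    have hw : (c - a : ℤ) = u + v := by omega
    have hu0 : 0 < u := by omega
    have hv0 : 0 < v := by omega
    have huv : u + v < 2 * k := by omega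
    rw [← hu] at h1
    rw [← hv] at h2
    rw [hw] at h4
    clear ha hb hc hu hv hw
    -- The gaps `u`, `v` and their sum would all be on the short list, which is arithmetically
    -- impossible.
    rcases h1 with h1 | h1 | h1 | h1 | h1 <;> rcases h2 with h2 | h2 | h2 | h2 | h2 <;>
      rcases h4 with h4 | h4 | h4 | h4 | h4 <;> omega
  have hle : (X \ leftEnds s X).card ≤ 2 * s := by
    by_contra hc
    have : 2 * s + 1 ≤ (X \ leftEnds s X).card := by omega
    nlinarith
  have := Finset.card_le_card_sdiff_add_card (s := X) (t := leftEnds s X)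
  omega

/-! ### Small indices: unwrapping to the integers -/

/-- A set in `ℤ/n` all of whose differences are represented by integers of absolute value less
than `n / 3` unwraps to a set of integers. -/
lemma exists_integer_model {n : ℕ} {L : ℤ} {P : ℤ → Prop} (hP : ∀ a, P a → |a| ≤ L)
    (hL : 3 * L < n) (X : Finset (ZMod n))
    (hX : ∀ x ∈ X, ∀ y ∈ X, ∃ a : ℤ, (a : ZMod n) = x - y ∧ P a) :
    ∃ Y : Finset ℤ, Y.card = X.card ∧ ∀ x ∈ Y, ∀ y ∈ Y, P (x - y) := by
  classical
  rcases X.eq_empty_or_nonempty with rfl | ⟨r, hr⟩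
  · exact ⟨∅, by simp⟩
  choose! f hf using fun x hx => hX x hx r hr
  refine ⟨X.image f, Finset.card_image_of_injOn ?_, ?_⟩
  · intro x hx y hy hxy
    have h1 := (hf x hx).1
    rw [hxy, (hf y hy).1] at h1
    exact (sub_left_injective h1).symm
  · intro u hu v hv
    obtain ⟨x, hx, rfl⟩ := Finset.mem_image.1 hu
    obtain ⟨y, hy, rfl⟩ := Finset.mem_image.1 hv
    obtain ⟨a, ha, hPa⟩ := hX x hx y hy
    have h1 := hP _ hPa
    have h2 := hP _ (hf x hx).2
    have h3 := hP _ (hf y hy).2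
    have h4 : (a : ZMod n) = ((f x - f y : ℤ) : ZMod n) := by
      rw [Int.cast_sub, (hf x hx).1, (hf y hy).1, ha]
      ring
    rw [ZMod.intCast_eq_intCast_iff_dvd_sub] at h4
    rw [abs_le] at h1 h2 h3
    have h5 : f x - f y - a = 0 :=
      Int.eq_zero_of_abs_lt_dvd h4 (abs_lt.2 (by omega))
    rwa [show f x - f y = a by omega]

lemma subset_Icc_of_abs_sub_le {L : ℤ} {Y : Finset ℤ} (hY : ∀ x ∈ Y, ∀ y ∈ Y, |x - y| ≤ L) :
    ∃ m : ℤ, Y ⊆ Finset.Icc m (m + L) := by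
  rcases Y.eq_empty_or_nonempty with rfl | hne
  · exact ⟨0, by simp⟩
  refine ⟨Y.min' hne, fun x hx => ?_⟩
  have h1 := Y.min'_le x hx
  have h2 := abs_le.1 (hY x hx _ (Y.min'_mem hne))
  rw [Finset.mem_Icc]
  omega

/-- Folding the upper half onto the lower by subtracting `s` is injective, as a collision would be a
difference `s`. -/
lemma card_le_of_no_difference {s : ℕ} {m : ℤ} {Z : Finset ℤ}
    (hZ : Z ⊆ Finset.Ico m (m + 2 * s)) (h : ∀ x ∈ Z, ∀ y ∈ Z, x - y ≠ s) : Z.card ≤ s := by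
  have : (Finset.Ico m (m + s)).card = s := by simp
  rw [← this]
  refine Finset.card_le_card_of_injOn (fun x => if x < m + s then x else x - s) ?_ ?_
  · intro x hx
    have h1 := Finset.mem_Ico.1 (hZ hx)
    simp only [Finset.coe_Ico, Set.mem_Ico]
    split_ifs <;> omega
  · intro x hx y hy hxy
    have h1 := h x hx y hy
    have h2 := h y hy x hx
    simp only at hxy
    split_ifs at hxy <;> omega

lemma card_le_of_isTwoStep_one {k s : ℕ} (hk : 4 ≤ k) (hs : 1 ≤ s)
    (X : Finset (ZMod (2 * s * k + 1)))
    (hX : ∀ x ∈ X, ∀ y ∈ X, ∃ a : ℤ, (a : ZMod (2 * s * k + 1)) = x - y ∧ IsTwoStep s 1 a) :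
    X.card ≤ 2 * s + 1 := by
  have hsk : (s * 4 : ℤ) ≤ s * k := by gcongr; exact_mod_cast hk
  obtain ⟨Y, hYX, hY⟩ := exists_integer_model (L := 2 * s)
    (fun a ha => by simpa using ha.abs_le (by omega) le_rfl) (by push_cast; linarith) X hX
  obtain ⟨m, hm⟩ := subset_Icc_of_abs_sub_le (L := 2 * s) fun x hx y hy => by
    simpa using (hY x hx y hy).abs_le (by omega) le_rfl
  have := Finset.card_le_card hm
  rw [Int.card_Icc] at this
  omega

/-- The difference `s` is forbidden, so each of two adjacent intervals of length `2s` holds at most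
`s` points; one endpoint remains. Unwrapping needs `12s < n`, hence `6 ≤ k`. -/
lemma card_le_of_isTwoStep_two {k s : ℕ} (hk : 6 ≤ k) (hs : 1 ≤ s)
    (X : Finset (ZMod (2 * s * k + 1)))
    (hX : ∀ x ∈ X, ∀ y ∈ X, ∃ a : ℤ, (a : ZMod (2 * s * k + 1)) = x - y ∧ IsTwoStep s 2 a) :
    X.card ≤ 2 * s + 1 := by
  classical
  have hsk : (s * 6 : ℤ) ≤ s * k := by gcongr; exact_mod_cast hk
  have hle : ∀ a : ℤ, IsTwoStep s 2 a → |a| ≤ 4 * s := fun a ha => by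
    have := ha.abs_le (by omega) (by omega)
    linarith
  obtain ⟨Y, hYX, hY⟩ := exists_integer_model (L := 4 * s) hle (by push_cast; linarith) X hX
  obtain ⟨m, hm⟩ := subset_Icc_of_abs_sub_le fun x hx y hy => hle _ (hY x hx y hy)
  have hne : ∀ x ∈ Y, ∀ y ∈ Y, x - y ≠ s := by
    intro x hx y hy hxy
    have := hY x hx y hy
    rw [hxy, IsTwoStep, abs_of_nonneg (by omega)] at this
    omega
  have h1 : (Y ∩ Finset.Ico m (m + 2 * s)).card ≤ s :=
    card_le_of_no_difference Finset.inter_subset_right fun x hx y hy =>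
      hne x (Finset.mem_inter.1 hx).1 y (Finset.mem_inter.1 hy).1
  have h2 : (Y ∩ Finset.Ico (m + 2 * s) (m + 2 * s + 2 * s)).card ≤ s :=
    card_le_of_no_difference Finset.inter_subset_right fun x hx y hy =>
      hne x (Finset.mem_inter.1 hx).1 y (Finset.mem_inter.1 hy).1
  have h3 : Y ⊆ (Y ∩ Finset.Ico m (m + 2 * s) ∪
      Y ∩ Finset.Ico (m + 2 * s) (m + 2 * s + 2 * s)) ∪ {m + 4 * s} := by
    intro x hx
    have := Finset.mem_Icc.1 (hm hx)
    simp only [Finset.mem_union, Finset.mem_inter, Finset.mem_Ico, Finset.mem_singleton]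
    simp only [hx, true_and]
    omega
  have h4 := (Finset.card_le_card h3).trans (Finset.card_union_le _ _)
  have h5 := Finset.card_union_le (Y ∩ Finset.Ico m (m + 2 * s))
    (Y ∩ Finset.Ico (m + 2 * s) (m + 2 * s + 2 * s))
  rw [Finset.card_singleton] at h4
  omega

/-! ### Diameter two subgraphs and dilation by units -/

lemma isDiameterTwo_iff {V : Type*} {G : SimpleGraph V} {H : G.Subgraph} :
    IsDiameterTwo H ↔ ∀ x ∈ H.verts, ∀ y ∈ H.verts,
      x = y ∨ H.Adj x y ∨ ∃ z, H.Adj x z ∧ H.Adj z y := by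
  classical
  constructor
  · intro h x hx y hy
    obtain ⟨p, -, hp⟩ := h ⟨x, hx⟩ ⟨y, hy⟩
    match p, hp with
    | .nil, _ => exact Or.inl rfl
    | .cons h1 .nil, _ => exact Or.inr (Or.inl h1)
    | .cons h1 (.cons h2 .nil), _ => exact Or.inr (Or.inr ⟨_, h1, h2⟩)
    | .cons h1 (.cons h2 (.cons h3 p)), hp =>
      simp only [SimpleGraph.Walk.length_cons] at hp
      omega
  · rintro h ⟨x, hx⟩ ⟨y, hy⟩
    suffices ∃ p : H.coe.Walk ⟨x, hx⟩ ⟨y, hy⟩, p.length ≤ 2 by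
      obtain ⟨p, hp⟩ := this
      exact ⟨p.bypass, p.bypass_isPath, p.length_bypass_le_length.trans hp⟩
    rcases h x hx y hy with rfl | h1 | ⟨z, h1, h2⟩
    · exact ⟨.nil, by simp⟩
    · exact ⟨.cons (show H.coe.Adj ⟨x, hx⟩ ⟨y, hy⟩ from h1) .nil, by simp⟩
    · have hz : z ∈ H.verts := H.edge_vert h2
      exact ⟨.cons (show H.coe.Adj ⟨x, hx⟩ ⟨z, hz⟩ from h1)
        (.cons (show H.coe.Adj ⟨z, hz⟩ ⟨y, hy⟩ from h2) .nil), by simp⟩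

lemma circleGraph_adj {n : ℕ} {S : Set ℕ} {x y : ZMod n} :
    (circleGraph n S).Adj x y ↔
      x ≠ y ∧ ∃ d ∈ S, (d : ZMod n) = x - y ∨ (d : ZMod n) = y - x := by
  simp only [circleGraph, SimpleGraph.circulantGraph_adj, Set.mem_image]
  constructor
  · rintro ⟨h, ⟨d, hd, h1⟩ | ⟨d, hd, h1⟩⟩
    · exact ⟨h, d, hd, Or.inl h1⟩
    · exact ⟨h, d, hd, Or.inr h1⟩
  · rintro ⟨h, d, hd, h1 | h1⟩
    · exact ⟨h, Or.inl ⟨d, hd, h1⟩⟩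
    · exact ⟨h, Or.inr ⟨d, hd, h1⟩⟩

/-- If, up to a unit of `ℤ/n`, all distances lie in `±[(i - 1)s + 1, is]`, then the diameter two
subgraphs of the circle graph are small. -/
lemma ncard_verts_le_of_dilate {k s i : ℕ} (hk : 4 ≤ k) (hs : 1 ≤ s)
    (hi : i = 1 ∨ (i = 2 ∧ 6 ≤ k) ∨ (3 ≤ i ∧ i ≤ k ∧ 3 * i ≠ 2 * k)) {T : Set ℕ}
    (c : (ZMod (2 * s * k + 1))ˣ)
    (hT : ∀ t ∈ T, ∃ a : ℤ, (t : ZMod (2 * s * k + 1)) = c * a ∧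
      ((i : ℤ) - 1) * s + 1 ≤ |a| ∧ |a| ≤ i * s)
    (H : (circleGraph (2 * s * k + 1) T).Subgraph) (hH : IsDiameterTwo H) :
    H.verts.ncard ≤ 2 * s + 7 := by
  classical
  rw [isDiameterTwo_iff] at hH
  have hadj : ∀ x y, H.Adj x y → ∃ a : ℤ, (a : ZMod (2 * s * k + 1)) = c⁻¹ * x - c⁻¹ * y ∧
      ((i : ℤ) - 1) * s + 1 ≤ |a| ∧ |a| ≤ i * s := by
    intro x y hxy
    obtain ⟨-, d, hd, h⟩ := circleGraph_adj.1 (H.adj_sub hxy)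
    obtain ⟨a, ha, hab⟩ := hT d hd
    rw [ha] at h
    rcases h with h | h
    · exact ⟨a, by rw [← mul_sub, ← h, Units.inv_mul_cancel_left], hab⟩
    · refine ⟨-a, ?_, by rwa [abs_neg]⟩
      rw [← mul_sub, ← neg_sub y x, ← h, mul_neg, Units.inv_mul_cancel_left, Int.cast_neg]
  set X : Finset (ZMod (2 * s * k + 1)) :=
    H.verts.toFinite.toFinset.image fun x => c⁻¹ * x with hXdef
  have hcard : H.verts.ncard = X.card := by
    rw [Set.ncard_eq_toFinset_card _ H.verts.toFinite, hXdef, Finset.card_image_of_injective]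
    exact fun x y h => (Units.mul_right_inj _).1 h
  have hX : ∀ x ∈ X, ∀ y ∈ X,
      ∃ a : ℤ, (a : ZMod (2 * s * k + 1)) = x - y ∧ IsTwoStep s i a := by
    intro u hu v hv
    obtain ⟨x, hx, rfl⟩ := Finset.mem_image.1 hu
    obtain ⟨y, hy, rfl⟩ := Finset.mem_image.1 hv
    rw [Set.Finite.mem_toFinset] at hx hy
    rcases hH x hx y hy with rfl | h | ⟨z, h1, h2⟩
    · exact ⟨0, by simp, isTwoStep_zero (by omega)⟩
    · obtain ⟨a, ha, hab⟩ := hadj x y h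
      exact ⟨a, ha, isTwoStep_of_interval hab⟩
    · obtain ⟨a, ha, hab⟩ := hadj x z h1
      obtain ⟨b, hb, hbb⟩ := hadj z y h2
      exact ⟨a + b, by rw [Int.cast_add, ha, hb]; ring, isTwoStep_add hab hbb⟩
  rw [hcard]
  rcases hi with rfl | ⟨rfl, hi⟩ | ⟨h3, hik, hne⟩
  · exact (card_le_of_isTwoStep_one hk hs X (by simpa using hX)).trans (by omega)
  · exact (card_le_of_isTwoStep_two hi hs X (by simpa using hX)).trans (by omega)
  · exact card_le_of_isTwoStep hk hs h3 hik hne X hX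

/-- Each distance set of the construction is, up to a unit of `ℤ/n`, an interval. -/
lemma exists_dilate_distanceSet {k s i : ℕ} (hk : 4 ≤ k) (hs : 1 ≤ s) (hi1 : 1 ≤ i) (hik : i ≤ k) :
    ∃ (j : ℕ) (c : (ZMod (2 * s * k + 1))ˣ),
      (j = 1 ∨ (j = 2 ∧ 6 ≤ k) ∨ (3 ≤ j ∧ j ≤ k ∧ 3 * j ≠ 2 * k)) ∧
      ∀ t ∈ distanceSet k s i, ∃ a : ℤ, (t : ZMod (2 * s * k + 1)) = c * a ∧
        ((j : ℤ) - 1) * s + 1 ≤ |a| ∧ |a| ≤ j * s := by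
  have hcop : Nat.Coprime 2 (2 * s * k + 1) := by
    rw [Nat.coprime_two_left]
    exact ⟨s * k, by ring⟩
  set two := ZMod.unitOfCoprime 2 hcop with htwo
  have hmul : ∀ (t : ℕ) (a : ℤ), ((t : ℤ) = 2 * a ∨ (t : ℤ) = 2 * a + (2 * s * k + 1)) →
      (t : ZMod (2 * s * k + 1)) = two * a := by
    intro t a h
    rw [htwo, ZMod.coe_unitOfCoprime]
    have h2 : ((2 * s * k + 1 : ℕ) : ZMod (2 * s * k + 1)) = 0 := ZMod.natCast_self _
    have h1 : ((t : ℤ) : ZMod (2 * s * k + 1)) = ((2 * a : ℤ) : ZMod (2 * s * k + 1)) := by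
      rcases h with h | h
      · rw [h]
      · rw [h, Int.cast_add]
        push_cast at h2 ⊢
        rw [h2, add_zero]
    push_cast at h1 ⊢
    exact h1
  unfold distanceSet
  split_ifs with h2 hA hB
  · obtain rfl | rfl : i = 1 ∨ i = 2 := by omega
    -- For odd `t`, `t = 2a + n` with `a = (t-1)/2 - sk`; this `-a` lies in the topmost interval.
    · refine ⟨k, two, by omega, fun t ht => ?_⟩
      obtain ⟨h3, h4, h5⟩ := ht
      have h6 : t % 2 = 1 := h5
      have hsk : (s : ℤ) ≤ s * k := by nlinarith
      refine ⟨((t : ℤ) - 1) / 2 - s * k, hmul _ _ (Or.inr ?_), ?_⟩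
      · rw [mul_sub, mul_assoc]
        omega
      · have e : ((k : ℤ) - 1) * s = s * k - s := by ring
        rw [abs_of_nonpos (by omega), e, mul_comm (k : ℤ)]
        omega
    · refine ⟨1, two, by omega, fun t ht => ?_⟩
      obtain ⟨h3, h4, h5⟩ := ht
      have h6 : t % 2 = 0 := h5
      refine ⟨(t : ℤ) / 2, hmul _ _ (Or.inl (by omega)), ?_⟩
      rw [abs_of_nonneg (by omega)]
      push_cast
      omega
  · obtain ⟨j, rfl⟩ : ∃ j, k = 3 * j := ⟨k / 3, by omega⟩
    obtain rfl : i = 2 * j - 1 := by omega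
    -- Here `j = k/3`; the value `j = 2` arises only from this case, with `k = 6`.
    refine ⟨j, two, by omega, fun t ht => ?_⟩
    obtain ⟨h3, h4, h5⟩ := ht
    have e1 : (2 * j - 1 - 1) * s + 2 = 2 * (j * s) - 2 * s + 2 := by
      rw [show 2 * j - 1 - 1 = 2 * j - 2 by omega, Nat.sub_mul, mul_assoc]
    have e2 : (2 * j - 1 + 1) * s = 2 * (j * s) := by
      rw [show 2 * j - 1 + 1 = 2 * j by omega, mul_assoc]
    have e3 : s ≤ j * s := Nat.le_mul_of_pos_left _ (by omega)
    have e4 : ((j : ℤ) - 1) * s = ((j * s : ℕ) : ℤ) - s := by push_cast; ring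
    rw [e1] at h3 h5
    rw [e2] at h4
    unfold Nat.ModEq at h5
    refine ⟨(t : ℤ) / 2, hmul _ _ (Or.inl (by omega)), ?_⟩
    rw [abs_of_nonneg (by omega), e4, ← Nat.cast_mul]
    omega
  · obtain ⟨j, rfl⟩ : ∃ j, k = 3 * j := ⟨k / 3, by omega⟩
    obtain rfl : i = 2 * j := by omega
    refine ⟨2 * j + 1, two, by omega, fun t ht => ?_⟩
    obtain ⟨h3, h4, h5⟩ := ht
    have e1 : (2 * j - 2) * s + 1 = 2 * (j * s) - 2 * s + 1 := by
      rw [Nat.sub_mul, mul_assoc]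
    have e3 : s ≤ j * s := Nat.le_mul_of_pos_left _ (by omega)
    have e5 : (s : ℤ) * ((3 * j : ℕ) : ℤ) = 3 * ((j * s : ℕ) : ℤ) := by push_cast; ring
    have e6 : (((2 * j + 1 : ℕ) : ℤ) - 1) * s = 2 * ((j * s : ℕ) : ℤ) := by push_cast; ring
    have e7 : ((2 * j + 1 : ℕ) : ℤ) * s = 2 * ((j * s : ℕ) : ℤ) + s := by push_cast; ring
    rw [e1] at h3 h5
    rw [mul_assoc] at h4
    unfold Nat.ModEq at h5
    refine ⟨((t : ℤ) - 1) / 2 - 3 * ((j * s : ℕ) : ℤ), hmul _ _ (Or.inr ?_), ?_⟩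
    · rw [mul_assoc, e5]
      omega
    · rw [abs_of_nonpos (by omega), e6, e7]
      omega
  · refine ⟨i, 1, by omega, fun t ht => ?_⟩
    obtain ⟨h3, h4, -⟩ := ht
    refine ⟨t, by simp, ?_⟩
    rw [abs_of_nonneg (by omega)]
    zify [hi1] at h3 h4
    exact ⟨h3, h4⟩

/-! ### The circle graphs partition the complete graph -/

/-- Membership in the distance sets in terms of the block `(qs, (q + 1)s]` of `d` and parity. -/
lemma mem_distanceSet_iff {k s i d : ℕ} (hk : 4 ≤ k) (hs : 1 ≤ s) (hi1 : 1 ≤ i) (hd : 1 ≤ d) :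
    d ∈ distanceSet k s i ↔
      (i = 1 ∧ (d - 1) / s ≤ 1 ∧ d % 2 = 1) ∨ (i = 2 ∧ (d - 1) / s ≤ 1 ∧ d % 2 = 0) ∨
      (3 ≤ i ∧ 3 * (i + 1) = 2 * k ∧ i - 1 ≤ (d - 1) / s ∧ (d - 1) / s ≤ i ∧ d % 2 = 0) ∨
      (3 ≤ i ∧ 3 * i = 2 * k ∧ i - 2 ≤ (d - 1) / s ∧ (d - 1) / s ≤ i - 1 ∧ d % 2 = 1) ∨
      (3 ≤ i ∧ 3 * (i + 1) ≠ 2 * k ∧ 3 * i ≠ 2 * k ∧ (d - 1) / s = i - 1) := by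
  have key : ∀ c, c ≤ (d - 1) / s ↔ c * s + 1 ≤ d := fun c => by
    rw [Nat.le_div_iff_mul_le (by omega)]
    omega
  generalize (d - 1) / s = q at *
  unfold distanceSet
  split_ifs with h2 hA hB
  · have h := key 2
    obtain rfl | rfl : i = 1 ∨ i = 2 := by omega
    · simp only [modInterval, Set.mem_ofPred_eq, Nat.ModEq, true_and]
      omega
    · simp only [modInterval, Set.mem_ofPred_eq, Nat.ModEq, true_and]
      omega
  · obtain ⟨j, rfl⟩ : ∃ j, k = 3 * j := ⟨k / 3, by omega⟩
    have e1 : (i - 1) * s = 2 * ((j - 1) * s) := by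
      rw [show i - 1 = 2 * (j - 1) by omega, mul_assoc]
    have e2 : (i + 1) * s = 2 * (j * s) := by
      rw [show i + 1 = 2 * j by omega, mul_assoc]
    have h3 := key (i - 1)
    have h4 := key (i + 1)
    simp only [modInterval, Set.mem_ofPred_eq, Nat.ModEq]
    omega
  · obtain ⟨j, rfl⟩ : ∃ j, k = 3 * j := ⟨k / 3, by omega⟩
    have e1 : (i - 2) * s = 2 * ((j - 1) * s) := by
      rw [show i - 2 = 2 * (j - 1) by omega, mul_assoc]
    have e2 : i * s = 2 * (j * s) := by
      rw [show i = 2 * j by omega, mul_assoc]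
    have h3 := key (i - 2)
    have h4 := key i
    simp only [modInterval, Set.mem_ofPred_eq, Nat.ModEq]
    omega
  · have h3 := key (i - 1)
    have h4 := key i
    simp only [modInterval, Set.mem_ofPred_eq, Nat.ModEq, Nat.mod_one, and_true]
    omega

lemma distanceSet_subset {k s i : ℕ} (hk : 4 ≤ k) (hs : 1 ≤ s) (hi1 : 1 ≤ i) (hik : i ≤ k) :
    distanceSet k s i ⊆ Set.Icc 1 (s * k) := by
  intro d hd
  have h1 : 1 ≤ d := by
    unfold distanceSet at hd
    split_ifs at hd <;> have := hd.1 <;> omega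
  rw [mem_distanceSet_iff hk hs hi1 h1] at hd
  have h2 : (d - 1) / s < k := by omega
  rw [Nat.div_lt_iff_lt_mul (by omega), mul_comm] at h2
  exact ⟨h1, by omega⟩

lemma distanceSet_index_unique {k s i j d : ℕ} (hk : 4 ≤ k) (hs : 1 ≤ s) (hi : i ∈ Set.Icc 1 k)
    (hj : j ∈ Set.Icc 1 k) (hdi : d ∈ distanceSet k s i) (hdj : d ∈ distanceSet k s j) :
    i = j := by
  obtain ⟨hi1, hik⟩ := hi
  obtain ⟨hj1, hjk⟩ := hj
  have hd := (distanceSet_subset hk hs hi1 hik hdi).1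
  rw [mem_distanceSet_iff hk hs hi1 hd] at hdi
  rw [mem_distanceSet_iff hk hs hj1 hd] at hdj
  generalize (d - 1) / s = q at *
  rcases hdi with h | h | h | h | h <;> rcases hdj with h' | h' | h' | h' | h' <;> omega

lemma exists_mem_distanceSet {k s d : ℕ} (hk : 4 ≤ k) (hs : 1 ≤ s) (hd : 1 ≤ d)
    (hdk : d ≤ s * k) : ∃ i ∈ Set.Icc 1 k, d ∈ distanceSet k s i := by
  have hq : (d - 1) / s < k := by
    rw [Nat.div_lt_iff_lt_mul (by omega), mul_comm]
    omega
  have key : ∀ i, 1 ≤ i → _ := fun i hi => mem_distanceSet_iff (d := d) (i := i) hk hs hi hd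
  suffices ∃ i, ∃ h : 1 ≤ i, i ≤ k ∧ _ by
    obtain ⟨i, h1, h2, h3⟩ := this
    exact ⟨i, ⟨h1, h2⟩, (key i h1).2 h3⟩
  clear key
  generalize (d - 1) / s = q at *
  by_cases h1 : q ≤ 1
  · rcases Nat.mod_two_eq_zero_or_one d with h2 | h2
    · exact ⟨2, by omega, by omega, by omega⟩
    · exact ⟨1, by omega, by omega, by omega⟩
  by_cases h3 : 3 * (q + 1) = 2 * k
  · rcases Nat.mod_two_eq_zero_or_one d with h2 | h2
    · exact ⟨q, by omega, by omega, by omega⟩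
    · exact ⟨q + 1, by omega, by omega, by omega⟩
  by_cases h4 : 3 * (q + 2) = 2 * k
  · rcases Nat.mod_two_eq_zero_or_one d with h2 | h2
    · exact ⟨q + 1, by omega, by omega, by omega⟩
    · exact ⟨q + 2, by omega, by omega, by omega⟩
  · exact ⟨q + 1, by omega, by omega, by omega⟩

lemma eq_of_natCast_eq_or_neg {n d e : ℕ} (hd : 2 * d < n) (he : 2 * e < n) (hd0 : 1 ≤ d)
    (h : (d : ZMod n) = e ∨ (d : ZMod n) = -e) : d = e := by
  rcases h with h | h
  · rw [ZMod.natCast_eq_natCast_iff', Nat.mod_eq_of_lt (by omega), Nat.mod_eq_of_lt (by omega)] at h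
    exact h
  · rw [eq_neg_iff_add_eq_zero, ← Nat.cast_add, ZMod.natCast_eq_zero_iff] at h
    exact absurd (Nat.le_of_dvd (by omega) h) (by omega)

lemma pairwiseDisjoint_edgeSet {k s : ℕ} (hk : 4 ≤ k) (hs : 1 ≤ s) :
    (Set.Icc 1 k).PairwiseDisjoint
      fun i => (circleGraph (2 * s * k + 1) (distanceSet k s i)).edgeSet := by
  intro i hi j hj hij
  refine Set.disjoint_left.2 fun e he he' => hij ?_
  induction e using Sym2.inductionOn with
  | _ x y =>
    rw [SimpleGraph.mem_edgeSet, circleGraph_adj] at he he'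
    obtain ⟨-, d, hd, h⟩ := he
    obtain ⟨-, d', hd', h'⟩ := he'
    have h1 := distanceSet_subset hk hs hi.1 hi.2 hd
    have h2 := distanceSet_subset hk hs hj.1 hj.2 hd'
    rw [Set.mem_Icc] at h1 h2
    have h3 : d = d' := by
      refine eq_of_natCast_eq_or_neg (n := 2 * s * k + 1) ?_ ?_ h1.1 ?_
      · rw [mul_assoc]; omega
      · rw [mul_assoc]; omega
      · rcases h with h | h <;> rcases h' with h' | h' <;> rw [h, h'] <;> simp
    subst h3
    exact distanceSet_index_unique hk hs hi hj hd hd'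

lemma iUnion_edgeSet {k s : ℕ} (hk : 4 ≤ k) (hs : 1 ≤ s) :
    (⋃ i ∈ Set.Icc 1 k, (circleGraph (2 * s * k + 1) (distanceSet k s i)).edgeSet) =
      (⊤ : SimpleGraph (ZMod (2 * s * k + 1))).edgeSet := by
  ext e
  induction e using Sym2.inductionOn with
  | _ x y =>
    simp only [Set.mem_iUnion, SimpleGraph.mem_edgeSet, circleGraph_adj, SimpleGraph.top_adj,
      exists_prop]
    refine ⟨fun ⟨_, _, h, _⟩ => h, fun h => ?_⟩
    have h0 : (x - y).valMinAbs ≠ 0 := by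
      rw [Ne, ZMod.valMinAbs_eq_zero, sub_eq_zero]
      exact h
    have h1 := ZMod.natAbs_valMinAbs_le (x - y)
    have h2 := ZMod.coe_valMinAbs (x - y)
    obtain ⟨i, hi, hd⟩ := exists_mem_distanceSet hk hs (d := (x - y).valMinAbs.natAbs)
      (by omega) (h1.trans (by rw [mul_assoc]; omega))
    refine ⟨i, hi, h, _, hd, ?_⟩
    generalize (x - y).valMinAbs = v at *
    rw [← neg_sub x y, ← h2]
    rcases Int.natAbs_eq v with h3 | h3
    · left
      rw [← Int.cast_natCast, ← h3]
    · right
      rw [← Int.cast_natCast, ← Int.cast_neg]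
      exact congrArg _ (by omega)

lemma ncard_verts_le {k s i : ℕ} (hk : 4 ≤ k) (hs : 1 ≤ s) (hi : i ∈ Set.Icc 1 k)
    (H : (circleGraph (2 * s * k + 1) (distanceSet k s i)).Subgraph) (hH : IsDiameterTwo H) :
    H.verts.ncard ≤ 2 * s + 7 := by
  obtain ⟨j, c, hj, hT⟩ := exists_dilate_distanceSet hk hs hi.1 hi.2
  exact ncard_verts_le_of_dilate hk hs hj c hT H hH

/-! ### Bounds for all `n` and the limit -/

lemma IsDiameterTwo.map {V W : Type*} {G : SimpleGraph V} {G' : SimpleGraph W} (f : G →g G')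
    {H : G.Subgraph} (hH : IsDiameterTwo H) : IsDiameterTwo (H.map f) := by
  rw [isDiameterTwo_iff] at *
  rintro _ ⟨x, hx, rfl⟩ _ ⟨y, hy, rfl⟩
  rcases hH x hx y hy with rfl | h | ⟨z, h1, h2⟩
  · exact Or.inl rfl
  · exact Or.inr (Or.inl ⟨x, y, h, rfl, rfl⟩)
  · exact Or.inr (Or.inr ⟨f z, ⟨x, z, h1, rfl, rfl⟩, ⟨z, y, h2, rfl, rfl⟩⟩)

/-- `K_n` embeds in `ℤ/(2sk+1)` and inherits the colouring; the embedding carries diameter two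
subgraphs to diameter two subgraphs of the same size. -/
lemma guaranteedSize_le {k s n : ℕ} (hk : 4 ≤ k) (hs : 1 ≤ s) (hn : n ≤ 2 * s * k + 1) :
    guaranteedSize k n ≤ 2 * s + 7 := by
  classical
  have hinj : Function.Injective fun x : Fin n => ((x : ℕ) : ZMod (2 * s * k + 1)) := by
    intro x y hxy
    simp only at hxy
    rw [ZMod.natCast_eq_natCast_iff', Nat.mod_eq_of_lt (by omega),
      Nat.mod_eq_of_lt (by omega)] at hxy
    exact Fin.ext hxy
  have hcol : ∀ e : (⊤ : SimpleGraph (Fin n)).edgeSet, ∃ i : Fin k,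
      Sym2.map (fun x : Fin n => ((x : ℕ) : ZMod (2 * s * k + 1))) e ∈
        (circleGraph (2 * s * k + 1) (distanceSet k s (i + 1))).edgeSet := by
    rintro ⟨e, he⟩
    have : Sym2.map (fun x : Fin n => ((x : ℕ) : ZMod (2 * s * k + 1))) e ∈
        (⊤ : SimpleGraph (ZMod (2 * s * k + 1))).edgeSet := by
      induction e using Sym2.inductionOn with
      | _ x y =>
        rw [Sym2.map_mk, SimpleGraph.mem_edgeSet, SimpleGraph.top_adj]
        exact hinj.ne he
    rw [← iUnion_edgeSet hk hs] at this
    simp only [Set.mem_iUnion] at this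
    obtain ⟨i, ⟨hi1, hik⟩, h⟩ := this
    refine ⟨⟨i - 1, by omega⟩, ?_⟩
    simpa only [Nat.sub_add_cancel hi1] using h
  choose c hc using hcol
  refine csSup_le' fun m hm => ?_
  obtain ⟨i, H, hH, hmH⟩ := hm c
  let f : SimpleGraph.EdgeLabeling.labelGraph (G := ⊤) c i →g
      circleGraph (2 * s * k + 1) (distanceSet k s (i + 1)) :=
    { toFun := fun x => ((x : ℕ) : ZMod (2 * s * k + 1))
      map_rel' := by
        intro x y hxy
        obtain ⟨h, h'⟩ := (SimpleGraph.EdgeLabeling.labelGraph_adj x y).1 hxy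
        have := hc ⟨s(x, y), h⟩
        rw [h'] at this
        exact this }
  have h1 := ncard_verts_le hk hs (i := i + 1) ⟨by omega, by omega⟩ (H.map f) (hH.map f)
  exact hmH.trans ((Set.ncard_image_of_injective H.verts hinj).symm.le.trans h1)

/-- The star at `v` is a diameter two subgraph. -/
lemma exists_isDiameterTwo_star {V : Type*} (G : SimpleGraph V) (v : V) :
    ∃ H : G.Subgraph, IsDiameterTwo H ∧ H.verts = insert v (G.neighborSet v) := by
  refine ⟨{ verts := insert v (G.neighborSet v)
            Adj := fun x y => G.Adj x y ∧ (x = v ∨ y = v)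
            adj_sub := fun h => h.1
            edge_vert := ?_
            symm := ⟨fun x y h => ⟨h.1.symm, h.2.symm⟩⟩ }, ?_, rfl⟩
  · rintro x y ⟨h, rfl | rfl⟩
    · exact Set.mem_insert _ _
    · exact Set.mem_insert_of_mem _ h.symm
  · rw [isDiameterTwo_iff]
    rintro x (rfl | hx) y (rfl | hy)
    · exact Or.inl rfl
    · exact Or.inr (Or.inl ⟨hy, Or.inl rfl⟩)
    · exact Or.inr (Or.inl ⟨SimpleGraph.Adj.symm hx, Or.inr rfl⟩)
    · exact Or.inr (Or.inr ⟨v, ⟨SimpleGraph.Adj.symm hx, Or.inr rfl⟩, ⟨hy, Or.inl rfl⟩⟩)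

lemma le_guaranteedSize {k n : ℕ} (hk : 1 ≤ k) (hn : 1 ≤ n) :
    1 + ((n : ℝ) - 1) / k ≤ guaranteedSize k n := by
  classical
  have : NeZero n := ⟨by omega⟩
  have : NeZero k := ⟨by omega⟩
  refine (Nat.le_ceil _).trans (Nat.cast_le.2 (le_csSup ?_ ?_))
  · refine ⟨n, fun m hm => ?_⟩
    obtain ⟨i, H, -, h⟩ := hm fun _ => 0
    refine h.trans ((Set.ncard_le_ncard (Set.subset_univ _)).trans ?_)
    rw [Set.ncard_univ, Nat.card_eq_fintype_card, Fintype.card_fin]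
  · intro c
    -- Pigeonhole on the colours of the `n - 1` edges at vertex 0; the default colour is never used
    -- because 0 is erased.
    obtain ⟨i, -, hi⟩ := Finset.exists_le_card_fiber_of_nsmul_le_card_of_maps_to
      (s := Finset.univ.erase (0 : Fin n)) (t := (Finset.univ : Finset (Fin k)))
      (f := fun x => if h : (0 : Fin n) ≠ x then c.get 0 x h else 0) (b := ((n : ℝ) - 1) / k)
      (fun _ _ => Finset.mem_univ _) ⟨0, Finset.mem_univ _⟩ (by
        rw [Finset.card_erase_of_mem (Finset.mem_univ _), Finset.card_univ, Finset.card_univ,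
          Fintype.card_fin, Fintype.card_fin, Nat.cast_sub hn, nsmul_eq_mul, Nat.cast_one,
          mul_div_cancel₀ _ (by positivity)])
    obtain ⟨H, hH, hv⟩ := exists_isDiameterTwo_star (c.labelGraph i) 0
    refine ⟨i, H, hH, ?_⟩
    have hsub : ((insert 0 ((Finset.univ.erase (0 : Fin n)).filter fun x =>
        (if h : (0 : Fin n) ≠ x then c.get 0 x h else 0) = i) : Finset (Fin n)) : Set (Fin n)) ⊆
        H.verts := by
      rw [hv, Finset.coe_insert]
      refine Set.insert_subset_insert fun x hx => ?_
      simp only [Finset.coe_filter, Finset.mem_erase, Set.mem_ofPred_eq] at hx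
      obtain ⟨⟨hx0, -⟩, hx1⟩ := hx
      rw [dif_pos hx0.symm] at hx1
      exact (SimpleGraph.TopEdgeLabeling.labelGraph_adj _ _).2 ⟨hx0.symm, hx1⟩
    have h1 := Set.ncard_le_ncard hsub
    rw [Set.ncard_coe_finset, Finset.card_insert_of_notMem (by simp)] at h1
    refine Nat.ceil_le.2 (le_trans ?_ (Nat.cast_le.2 h1))
    push_cast
    linarith

theorem theorem3 (k : ℕ) (hk : 4 ≤ k) :
    (∀ s : ℕ, 1 ≤ s →
      (∀ i ∈ Set.Icc 1 k, distanceSet k s i ⊆ Set.Icc 1 ((2 * s * k + 1) / 2)) ∧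
      ((Set.Icc 1 k).PairwiseDisjoint
        fun i => (circleGraph (2 * s * k + 1) (distanceSet k s i)).edgeSet) ∧
      (⋃ i ∈ Set.Icc 1 k, (circleGraph (2 * s * k + 1) (distanceSet k s i)).edgeSet) =
        (⊤ : SimpleGraph (ZMod (2 * s * k + 1))).edgeSet ∧
      ∀ i ∈ Set.Icc 1 k,
        ∀ H : (circleGraph (2 * s * k + 1) (distanceSet k s i)).Subgraph,
          IsDiameterTwo H → H.verts.ncard ≤ 2 * s + 7) ∧
    (∀ n : ℕ, 1 ≤ n → 1 + ((n : ℝ) - 1) / k ≤ guaranteedSize k n) ∧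
    Filter.Tendsto (fun n : ℕ => (guaranteedSize k n : ℝ) / (1 + ((n : ℝ) - 1) / k))
      Filter.atTop (nhds 1) := by
  have hlow : ∀ n : ℕ, 1 ≤ n → 1 + ((n : ℝ) - 1) / k ≤ guaranteedSize k n :=
    fun n hn => le_guaranteedSize (by omega) hn
  have hk0 : (0 : ℝ) < k := by
    have : 0 < k := by omega
    exact_mod_cast this
  refine ⟨fun s hs => ⟨fun i hi => ?_, pairwiseDisjoint_edgeSet hk hs, iUnion_edgeSet hk hs,
    fun i hi H hH => ncard_verts_le hk hs hi H hH⟩, hlow, ?_⟩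
  · refine (distanceSet_subset hk hs hi.1 hi.2).trans (Set.Icc_subset_Icc_right ?_)
    rw [mul_assoc]
    omega
  have hpos : ∀ n : ℕ, 1 ≤ n → 0 < 1 + ((n : ℝ) - 1) / k := fun n hn => by
    have : (1 : ℝ) ≤ n := by exact_mod_cast hn
    have := div_nonneg (sub_nonneg.2 this) hk0.le
    linarith
  have htop : Filter.Tendsto (fun n : ℕ => 1 + ((n : ℝ) - 1) / k) Filter.atTop Filter.atTop :=
    Filter.tendsto_atTop_add_const_left _ _
      ((Filter.tendsto_atTop_add_const_right _ (-1)
        tendsto_natCast_atTop_atTop).atTop_div_const hk0)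
  -- With `s = ⌊(n-1)/(2k)⌋ + 1`, `2s + 7 ≤ (n-1)/k + 9`, which exceeds the lower bound by 8.
  have hup : Filter.Tendsto (fun n : ℕ => 1 + 8 / (1 + ((n : ℝ) - 1) / k)) Filter.atTop
      (nhds 1) := by
    simpa using (htop.const_div_atTop 8).const_add 1
  refine tendsto_of_tendsto_of_tendsto_of_le_of_le' tendsto_const_nhds hup ?_ ?_
  · filter_upwards [Filter.eventually_ge_atTop 1] with n hn
    exact (one_le_div (hpos n hn)).2 (hlow n hn)
  · filter_upwards [Filter.eventually_ge_atTop 1] with n hn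
    have hx := hpos n hn
    rw [div_le_iff₀ hx, add_mul, div_mul_cancel₀ _ hx.ne', one_mul]
    have hdiv := Nat.lt_div_mul_add (a := n - 1) (b := 2 * k) (by omega)
    have hs : 1 ≤ (n - 1) / (2 * k) + 1 := Nat.le_add_left _ _
    have h1 : guaranteedSize k n ≤ 2 * ((n - 1) / (2 * k) + 1) + 7 :=
      guaranteedSize_le hk hs (by
        have e : 2 * ((n - 1) / (2 * k) + 1) * k = (n - 1) / (2 * k) * (2 * k) + 2 * k := by ring
        rw [e]
        omega)
    have h2 : (((n - 1) / (2 * k) : ℕ) : ℝ) ≤ ((n : ℝ) - 1) / (2 * k) := by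
      refine Nat.cast_div_le.trans (le_of_eq ?_)
      push_cast [Nat.cast_sub hn]
      ring
    have h3 : ((n : ℝ) - 1) / (2 * k) * 2 = ((n : ℝ) - 1) / k := by
      field_simp
    have h4 : (guaranteedSize k n : ℝ) ≤ 2 * ((((n - 1) / (2 * k) : ℕ) : ℝ) + 1) + 7 := by
      exact_mod_cast h1
    linarith
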